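/- Let $k$ be a field, $A$ a finite-dimensional $k$-algebra, and $\operatorname{mod} A$ the category of finite-dimensional left $A$-modules. For $M\in\operatorname{mod}A$ with minimal projective presentation $P_1\xrightarrow{d}P_0\to M\to 0$, let $\tau M=\operatorname{Hom}_k(\operatorname{Coker}\operatorname{Hom}_A(d,A),k)$ be its Auslander–Reiten translate. $M$ is called $\tau$-tilting if $\operatorname{Hom}_A(M,\tau M)=0$ and the number of isomorphism classes of indecomposable direct summands of $M$ equals the number of isomorphism classes of simple $A$-modules; $M$ is called support $\tau$-tilting if there is an idempotent $e\in A$ such that $M$ is a $\tau$-tilting $A/AeA$-module (with $\tau$ taken over $A/AeA$). Let $\operatorname{Gen}T$ be the full subcategory of $\operatorname{mod}A$ of all quotients of finite direct sums of copies of $T$, and for a full subcategory $\mathcal X$ let ${}^{\perp_1}\mathcal X=\{Y\in\operatorname{mod}A\mid \operatorname{Ext}^1_A(Y,X)=0\text{ for all }X\in\mathcal X\}$. Theorem. Let $T\in\operatorname{mod}A$ be a support $\tau$-tilting module. Then $(\mathcal C,\mathcal T)=({}^{\perp_1}\operatorname{Gen}T,\operatorname{Gen}T)$ is a left weak cotorsion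 pair in $\operatorname{mod}A$, that is: 1. $\operatorname{Ext}^1_A(X,Y)=0$ for all $X\in\mathcal C$ and $Y\in\mathcal T$; 2. for every $M\in\operatorname{mod}A$ there are exact sequences $$0\to Y_M\to X_M\xrightarrow{f_M}M\to 0\qquad\text{and}\qquad M\xrightarrow{g^M}Y^M\to X^M\to 0$$ with $X_M,X^M\in\mathcal C$ and $Y_M,Y^M\in\mathcal T$, such that $f_M$ is a right $\mathcal C$-approximation of $M$ (every morphism from an object of $\mathcal C$ to $M$ factors through $f_M$) and $g^M$ is a left $\mathcal T$-approximation of $M$ (every morphism from $M$ to an object of $\mathcal T$ factors through $g^M$). -/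

import Mathlib

open CategoryTheory

universe w u

noncomputable section

namespace TauTilting

/-! ### Duals, transposes and the Auslander–Reiten translation -/

/-- The duality `D = Hom_k(-, k)`, from right `A`-modules (i.e. `Aᵐᵒᵖ`-modules) to left
`A`-modules. A type synonym, carrying the left `A`-action `(a • φ) x = φ (x a)`. -/
def KDual (k : Type*) (X : Type*) [Field k] [AddCommGroup X] [Module k X] : Type _ :=
  X →ₗ[k] k

instance KDual.addCommGroup (k : Type*) (X : Type*) [Field k] [AddCommGroup X] [Module k X] :
    AddCommGroup (KDual k X) :=
  inferInstanceAs (AddCommGroup (X →ₗ[k] k))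

instance KDual.module (k : Type*) (A : Type*) (X : Type*) [Field k] [Ring A] [AddCommGroup X]
    [Module k X]
    [Module Aᵐᵒᵖ X] [SMulCommClass Aᵐᵒᵖ k X] : Module A (KDual k X) where
  smul a φ := LinearMap.comp (φ : X →ₗ[k] k) (DistribSMul.toLinearMap k X (MulOpposite.op a))
  one_smul φ := LinearMap.ext fun x => congrArg (DFunLike.coe (F := X →ₗ[k] k) φ) (one_smul _ x)
  mul_smul a b φ := LinearMap.ext fun x =>
    congrArg (DFunLike.coe (F := X →ₗ[k] k) φ) (mul_smul (MulOpposite.op b) (MulOpposite.op a) x)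
  smul_zero _ := rfl
  smul_add _ _ _ := rfl
  add_smul a b φ := LinearMap.ext fun x =>
    (congrArg (DFunLike.coe (F := X →ₗ[k] k) φ)
      (add_smul (MulOpposite.op a) (MulOpposite.op b) x)).trans (LinearMap.map_add _ _ _)
  zero_smul φ := LinearMap.ext fun x =>
    (congrArg (DFunLike.coe (F := X →ₗ[k] k) φ) (zero_smul Aᵐᵒᵖ x)).trans (LinearMap.map_zero _)

section Translate

variable {A : Type u} [Ring A]

/-- A submodule `K` of `P` is superfluous if `N + K = P` only for `N = P`. -/
def IsSuperfluous {P : Type*} [AddCommGroup P] [Module A P] (K : Submodule A P) : Prop :=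
  ∀ N : Submodule A P, N ⊔ K = ⊤ → N = ⊤

/-- `P₁ --d--> P₀ --p--> M → 0` is a minimal projective presentation of `M` by finitely generated
projective modules: it is exact, and `P₀ → M` and `P₁ → im d` are projective covers. -/
structure IsMinimalProjectivePresentation {P₁ P₀ M : Type*} [AddCommGroup P₁] [Module A P₁]
    [AddCommGroup P₀] [Module A P₀] [AddCommGroup M] [Module A M]
    (d : P₁ →ₗ[A] P₀) (p : P₀ →ₗ[A] M) : Prop where
  finite_one : Module.Finite A P₁
  finite_zero : Module.Finite A P₀
  projective_one : Module.Projective A P₁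
  projective_zero : Module.Projective A P₀
  exact : Function.Exact d p
  surjective : Function.Surjective p
  superfluous_zero : IsSuperfluous (LinearMap.ker p)
  superfluous_one : IsSuperfluous (LinearMap.ker d)

/-- The map `Hom_A(d, A) : Hom_A(P₀, A) → Hom_A(P₁, A)` of right `A`-modules. -/
def homDual {P₁ P₀ : Type*} [AddCommGroup P₁] [Module A P₁] [AddCommGroup P₀] [Module A P₀]
    (d : P₁ →ₗ[A] P₀) : (P₀ →ₗ[A] A) →ₗ[Aᵐᵒᵖ] (P₁ →ₗ[A] A) where
  toFun f := f.comp d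
  map_add' _ _ := rfl
  map_smul' _ _ := rfl

/-- The cokernel of `Hom_A(d, A)`, a right `A`-module. If `d` is the first map of a minimal
projective presentation of `M`, this is the transpose `Tr M`. -/
abbrev Transpose {P₁ P₀ : Type*} [AddCommGroup P₁] [Module A P₁] [AddCommGroup P₀] [Module A P₀]
    (d : P₁ →ₗ[A] P₀) : Type _ :=
  (P₁ →ₗ[A] A) ⧸ LinearMap.range (homDual d)

/-- The left `A`-module `D (Coker Hom_A(d, A))`. If `d` is the first map of a minimal
projective presentation of `M`, this is the Auslander–Reiten translate `τ M = D Tr M`. -/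
abbrev ARTranslate (k : Type w) [Field k] [Algebra k A] {P₁ P₀ : Type*} [AddCommGroup P₁]
    [Module A P₁] [AddCommGroup P₀] [Module A P₀] (d : P₁ →ₗ[A] P₀) : Type _ :=
  KDual k (Transpose d)

/-- `Hom_A(M, τ M) = 0`, where `τ M` is computed from a minimal projective presentation of `M`
(which exists and is unique up to isomorphism). -/
def IsTauRigid (k : Type w) [Field k] [Algebra k A] (M : FGModuleCat.{u} A) : Prop :=
  ∃ (P₁ P₀ : FGModuleCat.{u} A) (d : P₁ →ₗ[A] P₀) (p : P₀ →ₗ[A] M),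
    IsMinimalProjectivePresentation d p ∧ ∀ h : M →ₗ[A] ARTranslate k d, h = 0

/-! ### τ-tilting and support τ-tilting modules -/

/-- `M` is nonzero and is not the direct sum of two nonzero submodules. -/
def IsIndecomposable (A : Type*) (M : Type*) [Ring A] [AddCommGroup M] [Module A M] : Prop :=
  Nontrivial M ∧ ∀ N N' : Submodule A M, IsCompl N N' → N = ⊥ ∨ N' = ⊥

/-- `M` has exactly `n` indecomposable direct summands up to isomorphism: `M ≅ ⨁ Nᵢ ^ mᵢ`
with `N₁, …, Nₙ` indecomposable and pairwise non-isomorphic and all `mᵢ > 0`. (By the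
Krull–Schmidt theorem `n` is determined by `M`; `M` is basic if all `mᵢ` are `1`.) -/
def HasIndecomposableSummands (M : FGModuleCat.{u} A) (n : ℕ) : Prop :=
  ∃ (N : Fin n → FGModuleCat.{u} A) (m : Fin n → ℕ),
    (∀ i, IsIndecomposable A (N i)) ∧ (∀ i, 0 < m i) ∧
    (∀ i j, Nonempty (N i ≃ₗ[A] N j) → i = j) ∧
    Nonempty (M ≃ₗ[A] ((i : Fin n) → Fin (m i) → N i))

/-- There are exactly `n` simple `A`-modules up to isomorphism. -/
def HasSimples (A : Type u) [Ring A] (n : ℕ) : Prop :=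
  ∃ S : Fin n → FGModuleCat.{u} A,
    (∀ i, IsSimpleModule A (S i)) ∧
    (∀ i j, Nonempty (S i ≃ₗ[A] S j) → i = j) ∧
    ∀ L : FGModuleCat.{u} A, IsSimpleModule A L → ∃ i, Nonempty (L ≃ₗ[A] S i)

/-- `M` is τ-tilting: `Hom(M, τ M) = 0`, and `M` has as many indecomposable direct summands as
there are simple `A`-modules (both counted up to isomorphism). -/
def IsTauTilting (k : Type w) [Field k] [Algebra k A] (M : FGModuleCat.{u} A) : Prop :=
  IsTauRigid k M ∧ ∃ n : ℕ, HasIndecomposableSummands M n ∧ HasSimples A n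

/-- The two-sided ideal `A e A`. -/
abbrev idealAeA (e : A) : Ideal A := (TwoSidedIdeal.span {e}).asIdeal

/-- `T` is support τ-tilting: for some idempotent `e`, `T` is (the restriction along `A → A / AeA`
of) a τ-tilting `A / AeA`-module. -/
def IsSupportTauTilting (k : Type w) [Field k] [Algebra k A] (T : FGModuleCat.{u} A) : Prop :=
  ∃ e : A, IsIdempotentElem e ∧ ∃ N : FGModuleCat.{u} (A ⧸ idealAeA e),
    IsTauTilting k N ∧
    Nonempty (T.obj ≅ (ModuleCat.restrictScalars (Ideal.Quotient.mk (idealAeA e))).obj N.obj)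

/-! ### Subcategories of `mod A` and left weak cotorsion pairs

A full subcategory of `mod A` is given by a property of the objects of `FGModuleCat A`. -/

/-- `Gen T`: the quotients of finite direct sums of copies of `T`. -/
def Gen (T : FGModuleCat.{u} A) : ObjectProperty (FGModuleCat.{u} A) := fun M =>
  ∃ (n : ℕ) (q : (Fin n → T) →ₗ[A] M), Function.Surjective q

/-- `Ext¹_A(X, Y) = 0`. -/
def ExtVanishes (X Y : FGModuleCat.{u} A) : Prop :=
  Subsingleton (Abelian.Ext X.obj Y.obj 1)

/-- The subcategory `{Y | Ext¹(Y, 𝒳) = 0}`. -/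
def leftExtPerp (𝒳 : ObjectProperty (FGModuleCat.{u} A)) : ObjectProperty (FGModuleCat.{u} A) :=
  fun Y => ∀ X, 𝒳 X → ExtVanishes Y X

/-- `f : X → M` is a right `𝒞`-approximation of `M`. -/
def IsRightApproximation (𝒞 : ObjectProperty (FGModuleCat.{u} A)) {X M : FGModuleCat.{u} A}
    (f : X →ₗ[A] M) : Prop :=
  𝒞 X ∧ ∀ X' : FGModuleCat.{u} A, 𝒞 X' → ∀ h : X' →ₗ[A] M, ∃ h' : X' →ₗ[A] X, f ∘ₗ h' = h

/-- `g : M → Y` is a left `𝒯`-approximation of `M`. -/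
def IsLeftApproximation (𝒯 : ObjectProperty (FGModuleCat.{u} A)) {M Y : FGModuleCat.{u} A}
    (g : M →ₗ[A] Y) : Prop :=
  𝒯 Y ∧ ∀ Y' : FGModuleCat.{u} A, 𝒯 Y' → ∀ h : M →ₗ[A] Y', ∃ h' : Y →ₗ[A] Y', h' ∘ₗ g = h

/-- `(𝒞, 𝒯)` is a left weak cotorsion pair in `mod A`: `Ext¹(𝒞, 𝒯) = 0`, and every `M` has exact
sequences `0 → Y --i--> X --f--> M → 0` and `M --g--> Y' --c--> X' → 0` with `X, X'` in `𝒞` and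
`Y, Y'` in `𝒯`, where `f` is a right `𝒞`-approximation and `g` a left `𝒯`-approximation. -/
structure IsLeftWeakCotorsionPair (𝒞 𝒯 : ObjectProperty (FGModuleCat.{u} A)) : Prop where
  ext_vanishes : ∀ X Y, 𝒞 X → 𝒯 Y → ExtVanishes X Y
  exists_right : ∀ M : FGModuleCat.{u} A, ∃ (Y X : FGModuleCat.{u} A) (i : Y →ₗ[A] X)
    (f : X →ₗ[A] M), 𝒞 X ∧ 𝒯 Y ∧ Function.Injective i ∧ Function.Exact i f ∧
      Function.Surjective f ∧ IsRightApproximation 𝒞 f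
  exists_left : ∀ M : FGModuleCat.{u} A, ∃ (Y X : FGModuleCat.{u} A) (g : M →ₗ[A] Y)
    (c : Y →ₗ[A] X), 𝒞 X ∧ 𝒯 Y ∧ Function.Exact g c ∧
      Function.Surjective c ∧ IsLeftApproximation 𝒯 g

end Translate

end TauTilting

end

/-!
Let `B = A / AeA` and let `P₁ → P₀ → T → 0` be a minimal projective presentation over `B`. As
`Hom(T, τT) = 0`, the Auslander–Reiten pairing shows that every map `P₁ → T`, and hence every map
from `P₁` to a quotient `Z` of `Tⁿ`, extends to `P₀`. Since `AeA` is an idempotent ideal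
annihilating `Z`, every map `AeA → Z` is zero, so `Ext¹_A(B, Z) = 0` and thus
`Ext¹_A(P₀, Z) = 0`. Together these give `Ext¹_A(T, Gen T) = 0`.

The two approximation sequences of `M` are then pushouts along a left `Gen T`-approximation
`g : Aʳ → Tⁿ` of a free module: of a surjection `Aʳ → M` for the left one, and of a map
`Aʳ → Aᵐ` with cokernel `M` for the right one. Every map `Aʳ → Z` with `Z` in `Gen T` factors
through `g`, which turns `Ext¹(Tⁿ, Z) = 0` into the vanishing of `Ext¹(-, Z)` on the cokernel of
`g` and on the pushout in the second case.
-/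

namespace TauTilting

open Abelian

/-! ### Vanishing of `Ext¹` -/

section Ext

theorem subsingleton_ext_of_sum_comp_eq_id {C : Type*} [Category C] [Abelian C] [HasExt C]
    {X Y : C} {n : ℕ} {ι : Type*} [Fintype ι] {W : ι → C} (a : ∀ i, X ⟶ W i) (b : ∀ i, W i ⟶ X)
    (hab : ∑ i, a i ≫ b i = 𝟙 X) (hW : ∀ i, Subsingleton (Ext (W i) Y n)) :
    Subsingleton (Ext X Y n) := by
  refine subsingleton_of_forall_eq 0 fun x ↦ ?_
  rw [← Ext.mk₀_id_comp x, ← hab, Ext.mk₀_sum, Ext.sum_comp]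
  refine Finset.sum_eq_zero fun i _ ↦ ?_
  rw [← Ext.mk₀_comp_mk₀_assoc, (hW i).elim ((Ext.mk₀ (b i)).comp x _) 0, Ext.comp_zero]

variable {A : Type u} [Ring A]

/-- `Ext¹_A(X, Z) = 0`, for modules that are neither bundled nor assumed finitely generated. For
objects of `FGModuleCat A` this unfolds to `ExtVanishes`. -/
abbrev ExtOneVanishes (A : Type u) [Ring A] (X Z : Type u) [AddCommGroup X] [Module A X]
    [AddCommGroup Z] [Module A Z] : Prop :=
  Subsingleton (Ext (ModuleCat.of A X) (ModuleCat.of A Z) 1)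

namespace ExtOneVanishes

variable {X W Z : Type u} [AddCommGroup X] [Module A X] [AddCommGroup W] [Module A W]
  [AddCommGroup Z] [Module A Z]

theorem of_projective [Module.Projective A X] : ExtOneVanishes A X Z :=
  Ext.subsingleton_of_projective _ _ 0

theorem of_retract (hW : ExtOneVanishes A W Z) (s : X →ₗ[A] W) (r : W →ₗ[A] X)
    (hrs : r ∘ₗ s = LinearMap.id) : ExtOneVanishes A X Z :=
  subsingleton_ext_of_sum_comp_eq_id (fun _ : Unit ↦ ModuleCat.ofHom s)
    (fun _ ↦ ModuleCat.ofHom r)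
    (by rw [Fintype.sum_unique, ← ModuleCat.ofHom_comp, hrs, ModuleCat.ofHom_id]) fun _ ↦ hW

theorem pi {ι : Type} [Finite ι] (hX : ExtOneVanishes A X Z) : ExtOneVanishes A (ι → X) Z := by
  classical
  have := Fintype.ofFinite ι
  refine subsingleton_ext_of_sum_comp_eq_id
    (fun i ↦ ModuleCat.ofHom (LinearMap.proj (R := A) (φ := fun _ : ι ↦ X) i))
    (fun i ↦ ModuleCat.ofHom (LinearMap.single A (fun _ : ι ↦ X) i)) ?_ fun _ ↦ hX
  ext x
  simp

theorem prod (hX : ExtOneVanishes A X Z) (hW : ExtOneVanishes A W Z) :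
    ExtOneVanishes A (X × W) Z :=
  subsingleton_ext_of_sum_comp_eq_id
    (W := fun b : Bool ↦ if b then ModuleCat.of A X else ModuleCat.of A W)
    (fun
      | true => ModuleCat.ofHom (LinearMap.fst A X W)
      | false => ModuleCat.ofHom (LinearMap.snd A X W))
    (fun
      | true => ModuleCat.ofHom (LinearMap.inl A X W)
      | false => ModuleCat.ofHom (LinearMap.inr A X W))
    (by rw [Fintype.sum_bool]; ext x <;> simp)
    (fun
      | true => hX
      | false => hW)

theorem of_exact {P : Type*} [AddCommGroup P] [Module A P] (hW : ExtOneVanishes A W Z)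
    {u : P →ₗ[A] W} {q : W →ₗ[A] X} (hq : Function.Surjective q) (huq : Function.Exact u q)
    (hext : ∀ b : P →ₗ[A] Z, ∃ c : W →ₗ[A] Z, c ∘ₗ u = b) : ExtOneVanishes A X Z := by
  refine subsingleton_of_forall_eq 0 fun x ↦ ?_
  have hS := LinearMap.shortExact_shortComplexKer hq
  obtain ⟨y, rfl⟩ := Ext.contravariant_sequence_exact₃ hS (ModuleCat.of A Z) x
    (hW.elim _ _) (n₀ := 0) rfl
  obtain ⟨f, rfl⟩ := (Ext.mk₀_bijective _ _).2 y
  have hu : ∀ p, u p ∈ LinearMap.ker q := fun p ↦ huq.apply_apply_eq_zero p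
  obtain ⟨c, hc⟩ := hext (f.hom ∘ₗ u.codRestrict _ hu)
  have hf : f = q.shortComplexKer.f ≫ ModuleCat.ofHom c := by
    ext ⟨w, hw⟩
    obtain ⟨p, rfl⟩ := (huq w).1 hw
    exact (LinearMap.congr_fun hc p).symm
  rw [hf, ← Ext.mk₀_comp_mk₀, hS.extClass_comp_assoc]

theorem exists_lift {E M : Type u} [AddCommGroup E] [Module A E] [AddCommGroup M] [Module A M]
    {f : E →ₗ[A] M} (hX : ExtOneVanishes A X (LinearMap.ker f)) (hf : Function.Surjective f)
    (h : X →ₗ[A] M) : ∃ h' : X →ₗ[A] E, f ∘ₗ h' = h := by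
  have hS := LinearMap.shortExact_shortComplexKer hf
  obtain ⟨y, hy⟩ := Ext.covariant_sequence_exact₃ (ModuleCat.of A X) hS
    (Ext.mk₀ (ModuleCat.ofHom h)) (n₁ := 1) rfl (hX.elim _ _)
  obtain ⟨g, rfl⟩ := (Ext.mk₀_bijective _ _).2 y
  rw [Ext.mk₀_comp_mk₀] at hy
  exact ⟨g.hom, congrArg ModuleCat.Hom.hom ((Ext.mk₀_bijective _ _).1 hy)⟩

end ExtOneVanishes

end Ext

/-! ### Pushouts of modules -/

section Pushout

variable {A P M N Z : Type*} [Ring A] [AddCommGroup P] [Module A P] [AddCommGroup M] [Module A M]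
  [AddCommGroup N] [Module A N] [AddCommGroup Z] [Module A Z]

/-- The pushout of `M ← P → N`, as the cokernel of `(f, -g) : P → M × N`. -/
abbrev Pushout (f : P →ₗ[A] M) (g : P →ₗ[A] N) : Type _ :=
  (M × N) ⧸ LinearMap.range (f.prod (-g))

namespace Pushout

variable (f : P →ₗ[A] M) (g : P →ₗ[A] N)

/-- The structure map `M → Pushout f g`. -/
def inl : M →ₗ[A] Pushout f g :=
  Submodule.mkQ _ ∘ₗ LinearMap.inl A M N

/-- The structure map `N → Pushout f g`. -/
def inr : N →ₗ[A] Pushout f g :=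
  Submodule.mkQ _ ∘ₗ LinearMap.inr A M N

variable {f g}

theorem mk_eq_inl_add_inr (m : M) (n : N) :
    Submodule.Quotient.mk (m, n) = inl f g m + inr f g n := by
  rw [inl, inr, LinearMap.comp_apply, LinearMap.comp_apply, ← map_add]
  simp

theorem inl_apply_eq_inr_apply (p : P) : inl f g (f p) = inr f g (g p) :=
  (Submodule.Quotient.eq _).2 ⟨p, by simp⟩

theorem inr_surjective (hf : Function.Surjective f) : Function.Surjective (inr f g) := by
  intro y
  obtain ⟨⟨m, n⟩, rfl⟩ := Submodule.Quotient.mk_surjective _ y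
  obtain ⟨p, rfl⟩ := hf m
  exact ⟨g p + n, by rw [mk_eq_inl_add_inr, inl_apply_eq_inr_apply, map_add]⟩

/-- The map out of `Pushout f g` with prescribed restrictions to `M` and `N`. -/
def desc (h : M →ₗ[A] Z) (h' : N →ₗ[A] Z) (w : h ∘ₗ f = h' ∘ₗ g) : Pushout f g →ₗ[A] Z :=
  Submodule.liftQ _ (h.coprod h') <| by
    rintro _ ⟨p, rfl⟩
    simpa [sub_eq_zero, ← sub_eq_add_neg] using LinearMap.congr_fun w p

variable {h : M →ₗ[A] Z} {h' : N →ₗ[A] Z}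

@[simp]
theorem desc_inl (w : h ∘ₗ f = h' ∘ₗ g) (m : M) : desc h h' w (inl f g m) = h m := by
  simp [desc, inl]

@[simp]
theorem desc_inr (w : h ∘ₗ f = h' ∘ₗ g) (n : N) : desc h h' w (inr f g n) = h' n := by
  simp [desc, inr]

theorem desc_surjective_of_left (hh : Function.Surjective h) (w : h ∘ₗ f = h' ∘ₗ g) :
    Function.Surjective (desc h h' w) :=
  fun z ↦ (hh z).imp' (inl f g) fun m hm ↦ (desc_inl w m).trans hm

theorem desc_surjective_of_right (hh' : Function.Surjective h') (w : h ∘ₗ f = h' ∘ₗ g) :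
    Function.Surjective (desc h h' w) :=
  fun z ↦ (hh' z).imp' (inr f g) fun n hn ↦ (desc_inr w n).trans hn

theorem exact_inl_desc (hgh : Function.Exact g h') (w : 0 ∘ₗ f = h' ∘ₗ g) :
    Function.Exact (inl f g) (desc 0 h' w) := by
  intro y
  obtain ⟨⟨m, n⟩, rfl⟩ := Submodule.Quotient.mk_surjective _ y
  rw [mk_eq_inl_add_inr, map_add, desc_inl, desc_inr, LinearMap.zero_apply, zero_add]
  refine ⟨fun hn ↦ ?_, ?_⟩
  · obtain ⟨p, rfl⟩ := (hgh n).1 hn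
    exact ⟨m + f p, by rw [map_add, inl_apply_eq_inr_apply]⟩
  · rintro ⟨m', hm'⟩
    simpa using (congrArg (desc 0 h' w) hm').symm

theorem exact_inr_desc (hfh : Function.Exact f h) (w : h ∘ₗ f = 0 ∘ₗ g) :
    Function.Exact (inr f g) (desc h 0 w) := by
  intro y
  obtain ⟨⟨m, n⟩, rfl⟩ := Submodule.Quotient.mk_surjective _ y
  rw [mk_eq_inl_add_inr, map_add, desc_inl, desc_inr, LinearMap.zero_apply, add_zero]
  refine ⟨fun hm ↦ ?_, ?_⟩
  · obtain ⟨p, rfl⟩ := (hfh m).1 hm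
    exact ⟨g p + n, by rw [map_add, inl_apply_eq_inr_apply]⟩
  · rintro ⟨n', hn'⟩
    simpa using (congrArg (desc h 0 w) hn').symm

end Pushout

end Pushout

/-! ### Maps into the Auslander–Reiten translate -/

section ARTranslate

variable {k : Type w} [Field k] {A : Type u} [Ring A] [Algebra k A]
variable {P₁ P₀ N : Type*} [AddCommGroup P₁] [Module A P₁] [AddCommGroup P₀] [Module A P₀]
  [AddCommGroup N] [Module A N]

section

variable [Module k N] [IsScalarTower k A N]

variable (k P₁) in
/-- The map `φ ↦ φ(-) t` from `Hom_A(P₁, A)` to `Hom_A(P₁, N)`, `k`-linear in `φ`. -/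
def smulRightHom (t : N) : (P₁ →ₗ[A] A) →ₗ[k] (P₁ →ₗ[A] N) where
  toFun φ := φ.smulRight t
  map_add' φ ψ := by ext; simp [add_smul]
  map_smul' c φ := by ext; simp

/-- The map `t ↦ (φ ↦ l (φ(-) t))` from `N` to `D Coker Hom_A(d, A)` attached to a functional `l`
on `Hom_A(P₁, N)` vanishing on the maps that factor through `d`. This is one direction of the
Auslander–Reiten isomorphism `D Coker Hom_A(d, N) ≅ Hom_A(N, D Coker Hom_A(d, A))`. -/
def toARTranslate (d : P₁ →ₗ[A] P₀) (l : (P₁ →ₗ[A] N) →ₗ[k] k)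
    (hl : ∀ f : P₀ →ₗ[A] N, l (f ∘ₗ d) = 0) : N →ₗ[A] ARTranslate k d where
  toFun t := ((LinearMap.range (homDual d)).restrictScalars k).liftQ (l ∘ₗ smulRightHom k P₁ t) (by
      rintro _ ⟨ψ, rfl⟩
      exact hl (ψ.smulRight t)) ∘ₗ
    (Submodule.Quotient.restrictScalarsEquiv k (LinearMap.range (homDual d))).symm.toLinearMap
  map_add' s t := by
    refine LinearMap.ext fun x ↦ ?_
    obtain ⟨φ, rfl⟩ := Submodule.Quotient.mk_surjective _ x
    change l (φ.smulRight (s + t)) = l (φ.smulRight s) + l (φ.smulRight t)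
    rw [← map_add]
    congr 1
    ext
    simp
  map_smul' a t := by
    refine LinearMap.ext fun x ↦ ?_
    obtain ⟨φ, rfl⟩ := Submodule.Quotient.mk_surjective _ x
    change l (φ.smulRight (a • t)) = l ((MulOpposite.op a • φ).smulRight t)
    congr 1
    ext
    simp [mul_smul]

theorem apply_smulRight_eq_zero_of_toARTranslate_eq_zero {d : P₁ →ₗ[A] P₀}
    {l : (P₁ →ₗ[A] N) →ₗ[k] k} {hl : ∀ f : P₀ →ₗ[A] N, l (f ∘ₗ d) = 0}
    (h : toARTranslate d l hl = 0) (φ : P₁ →ₗ[A] A) (t : N) : l (φ.smulRight t) = 0 :=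
  congrArg (fun ξ : ARTranslate k d ↦ (show Transpose d →ₗ[k] k from ξ)
    (Submodule.Quotient.mk φ)) (LinearMap.congr_fun h t)

end

theorem exists_eq_sum_smulRight [Module.Finite A P₁] [Module.Projective A P₁] (f : P₁ →ₗ[A] N) :
    ∃ (n : ℕ) (φ : Fin n → P₁ →ₗ[A] A) (t : Fin n → N), f = ∑ i, (φ i).smulRight (t i) := by
  obtain ⟨n, r, s, -, -, hrs⟩ := Module.Finite.exists_comp_eq_id_of_projective A P₁
  refine ⟨n, fun i ↦ LinearMap.proj i ∘ₗ s, fun i ↦ f (r (Pi.single i 1)), ?_⟩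
  ext x
  calc f x = f (r (s x)) := by rw [← LinearMap.comp_apply r, hrs, LinearMap.id_apply]
    _ = f (r (∑ i, s x i • Pi.single i 1)) := by rw [← pi_eq_sum_univ' (s x)]
    _ = _ := by simp [LinearMap.sum_apply]

theorem exists_extension_of_hom_ARTranslate_eq_zero [Module.Finite A P₁] [Module.Projective A P₁]
    {d : P₁ →ₗ[A] P₀} (hd : ∀ h : N →ₗ[A] ARTranslate k d, h = 0) (f : P₁ →ₗ[A] N) :
    ∃ g : P₀ →ₗ[A] N, g ∘ₗ d = f := by
  let : Module k N := Module.compHom N (algebraMap k A)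
  have : IsScalarTower k A N := .of_compHom k A N
  suffices hf : f ∈ LinearMap.range (LinearMap.lcomp k N d) from hf
  by_contra hf
  obtain ⟨l, hlf, hl⟩ := Submodule.exists_le_ker_of_notMem hf
  refine hlf ?_
  obtain ⟨n, φ, t, rfl⟩ := exists_eq_sum_smulRight f
  rw [map_sum]
  exact Finset.sum_eq_zero fun i _ ↦ apply_smulRight_eq_zero_of_toARTranslate_eq_zero
    (hd (toARTranslate d l fun g ↦ hl ⟨g, rfl⟩)) (φ i) (t i)

end ARTranslate

/-! ### Idempotent ideals -/

section IdempotentIdeal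

variable {A : Type u} [Ring A]

theorem isIdempotentElem_idealAeA {e : A} (he : IsIdempotentElem e) :
    IsIdempotentElem (idealAeA e) := by
  have he_mem : e ∈ idealAeA e := TwoSidedIdeal.subset_span (Set.mem_singleton e)
  refine le_antisymm Ideal.mul_le_left fun x hx ↦ ?_
  refine Ideal.mem_toTwoSided.1 (TwoSidedIdeal.mem_span_iff.1 hx _ ?_)
  have hee_mem : e * e ∈ idealAeA e * idealAeA e := Ideal.mul_mem_mul he_mem he_mem
  rwa [he.eq, ← Ideal.mem_toTwoSided, ← SetLike.mem_coe, ← Set.singleton_subset_iff] at hee_mem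

variable {I : Ideal A}

theorem linearMap_eq_zero_of_isIdempotentElem (hI : IsIdempotentElem I) {Z : Type*}
    [AddCommGroup Z] [Module A Z] (hZ : Module.IsTorsionBySet A Z I) (b : I →ₗ[A] Z) : b = 0 := by
  have hle : I * I ≤ (LinearMap.ker b).map I.subtype := by
    refine Ideal.mul_le.2 fun x hx y hy ↦ ⟨x • ⟨y, hy⟩, ?_, rfl⟩
    exact (map_smul b x _).trans (hZ (a := ⟨x, hx⟩))
  ext ⟨x, hx⟩
  obtain ⟨y, hy, rfl⟩ := hle (hI.symm ▸ hx : x ∈ I * I)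
  exact hy

variable [I.IsTwoSided]

theorem extOneVanishes_of_projective_quotient (hI : IsIdempotentElem I) {Q Z : Type u}
    [AddCommGroup Q] [Module A Q] [Module (A ⧸ I) Q] [IsScalarTower A (A ⧸ I) Q]
    [Module.Finite (A ⧸ I) Q] [Module.Projective (A ⧸ I) Q]
    [AddCommGroup Z] [Module A Z] (hZ : Module.IsTorsionBySet A Z I) : ExtOneVanishes A Q Z := by
  have hAI : ExtOneVanishes A (A ⧸ I) Z :=
    ExtOneVanishes.of_projective.of_exact I.mkQ_surjective (LinearMap.exact_subtype_mkQ I)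
      fun b ↦ ⟨0, by rw [LinearMap.zero_comp, linearMap_eq_zero_of_isIdempotentElem hI hZ b]⟩
  obtain ⟨n, r, s, -, -, hrs⟩ := Module.Finite.exists_comp_eq_id_of_projective (A ⧸ I) Q
  refine (hAI.pi (ι := Fin n)).of_retract (s.restrictScalars A) (r.restrictScalars A) ?_
  exact congrArg (LinearMap.restrictScalars A) hrs

theorem isScalarTower_compHom_mk (I : Ideal A) [I.IsTwoSided] (M : Type*) [AddCommGroup M]
    [Module (A ⧸ I) M] :
    letI : Module A M := Module.compHom M (Ideal.Quotient.mk I)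
    IsScalarTower A (A ⧸ I) M := by
  let : Module A M := Module.compHom M (Ideal.Quotient.mk I)
  refine ⟨fun a b x ↦ ?_⟩
  obtain ⟨b, rfl⟩ := Ideal.Quotient.mk_surjective b
  exact mul_smul (Ideal.Quotient.mk I a) (Ideal.Quotient.mk I b) x

theorem isTorsionBySet_of_isScalarTower_quotient (I : Ideal A) [I.IsTwoSided] (M : Type*)
    [AddCommGroup M] [Module A M] [Module (A ⧸ I) M] [IsScalarTower A (A ⧸ I) M] :
    Module.IsTorsionBySet A M I := by
  rintro x ⟨a, ha⟩
  have ha_one : a • (1 : A ⧸ I) = 0 :=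
    (Submodule.Quotient.mk_eq_zero I).2 (I.mul_mem_right 1 ha)
  rw [← one_smul (A ⧸ I) x, ← smul_assoc, ha_one, zero_smul]

theorem compatibleSMul_quotient (I : Ideal A) [I.IsTwoSided] (M N : Type*) [AddCommGroup M]
    [Module A M] [Module (A ⧸ I) M] [IsScalarTower A (A ⧸ I) M] [AddCommGroup N] [Module A N]
    [Module (A ⧸ I) N] [IsScalarTower A (A ⧸ I) N] :
    LinearMap.CompatibleSMul M N (A ⧸ I) A where
  map_smul f c x := by
    obtain ⟨a, rfl⟩ := Submodule.mkQ_surjective I c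
    have ha : I.mkQ a = a • (1 : A ⧸ I) := by
      rw [← mul_one a, ← smul_eq_mul, map_smul, smul_eq_mul, mul_one]
      rfl
    rw [ha, smul_assoc, smul_assoc, one_smul, one_smul, map_smul]

end IdempotentIdeal

/-! ### Modules generated by a module -/

theorem exists_extension_of_surjective_pi {A P W T Z : Type*} [Ring A] [AddCommGroup P]
    [Module A P] [Module.Projective A P] [AddCommGroup W] [Module A W] [AddCommGroup T]
    [Module A T] [AddCommGroup Z] [Module A Z] {u : P →ₗ[A] W}
    (hu : ∀ f : P →ₗ[A] T, ∃ g : W →ₗ[A] T, g ∘ₗ u = f) {ι : Type*} {q : (ι → T) →ₗ[A] Z}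
    (hq : Function.Surjective q) (b : P →ₗ[A] Z) : ∃ c : W →ₗ[A] Z, c ∘ₗ u = b := by
  obtain ⟨b', rfl⟩ := Module.projective_lifting_property q b hq
  choose c hc using fun i ↦ hu (LinearMap.proj i ∘ₗ b')
  exact ⟨q ∘ₗ LinearMap.pi c,
    LinearMap.ext fun x ↦ congrArg q (funext fun i ↦ LinearMap.congr_fun (hc i) x)⟩

section Gen

variable {A : Type u} [Ring A]

theorem extOneVanishes_of_isTauRigid_quotient {k : Type w} [Field k] [Algebra k A] {I : Ideal A}
    [I.IsTwoSided] (hI : IsIdempotentElem I) {N : FGModuleCat.{u} (A ⧸ I)} (hN : IsTauRigid k N)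
    [Module A N] [IsScalarTower A (A ⧸ I) N] {Z : Type u} [AddCommGroup Z] [Module A Z]
    {ι : Type*} {q : (ι → N) →ₗ[A] Z} (hq : Function.Surjective q) : ExtOneVanishes A N Z := by
  obtain ⟨P₁, P₀, d, p, hmin, hτ⟩ := hN
  have := hmin.projective_zero
  have := hmin.projective_one
  let : Module A P₁ := Module.compHom P₁ (Ideal.Quotient.mk I)
  have := isScalarTower_compHom_mk I P₁
  let : Module A P₀ := Module.compHom P₀ (Ideal.Quotient.mk I)
  have := isScalarTower_compHom_mk I P₀
  have hZ : Module.IsTorsionBySet A Z I := by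
    intro z a
    obtain ⟨y, rfl⟩ := hq z
    rw [← map_smul, isTorsionBySet_of_isScalarTower_quotient I (ι → N), map_zero]
  let := hZ.module
  have := compatibleSMul_quotient I (ι → N) Z
  have := compatibleSMul_quotient I P₁ Z
  refine (extOneVanishes_of_projective_quotient hI hZ (Q := P₀)).of_exact hmin.surjective
    (u := d.restrictScalars A) (q := p.restrictScalars A) hmin.exact fun b ↦ ?_
  obtain ⟨c, hc⟩ := exists_extension_of_surjective_pi
    (exists_extension_of_hom_ARTranslate_eq_zero hτ) (q := q.restrictScalars (A ⧸ I)) hq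
    (b.restrictScalars (A ⧸ I))
  exact ⟨c.restrictScalars A, LinearMap.ext fun x ↦ LinearMap.congr_fun hc x⟩

theorem IsSupportTauTilting.leftExtPerp_gen {k : Type w} [Field k] [Algebra k A]
    {T : FGModuleCat.{u} A} (hT : IsSupportTauTilting k T) : leftExtPerp (Gen T) T := by
  obtain ⟨e, he, N, ⟨hN, -⟩, ⟨φ⟩⟩ := hT
  rintro Z ⟨n, q, hq⟩
  let : Module A N := Module.compHom N (Ideal.Quotient.mk (idealAeA e))
  have := isScalarTower_compHom_mk (idealAeA e) N
  let ψ : T ≃ₗ[A] N := φ.toLinearEquiv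
  let ψn : (Fin n → N) ≃ₗ[A] (Fin n → T) := .piCongrRight fun _ ↦ ψ.symm
  have hN_Z : ExtOneVanishes A N Z := extOneVanishes_of_isTauRigid_quotient
    (isIdempotentElem_idealAeA he) hN (q := q ∘ₗ ψn.toLinearMap) (hq.comp ψn.surjective)
  exact hN_Z.of_retract ψ.toLinearMap ψ.symm.toLinearMap ψ.symm_comp

theorem finite_moduleEnd (R : Type*) {A M : Type*} [CommRing R] [Ring A] [Algebra R A]
    [Module.Finite R A] [AddCommGroup M] [Module A M] [Module.Finite A M] :
    Module.Finite (Module.End A M) M := by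
  let : Module R M := Module.compHom M (algebraMap R A)
  have : IsScalarTower R A M := .of_compHom R A M
  have : Module.Finite R M := .trans A M
  exact .of_restrictScalars_finite R (Module.End A M) M

theorem exists_isLeftApproximation_gen_of_projective (T P : FGModuleCat.{u} A)
    [Module.Projective A P] [Module.Finite (Module.End A T) (P →ₗ[A] T)] :
    ∃ (n : ℕ) (g : P →ₗ[A] FGModuleCat.of A (Fin n → T)), IsLeftApproximation (Gen T) g := by
  obtain ⟨n, s, hs⟩ := Module.Finite.exists_fin (R := Module.End A T) (M := P →ₗ[A] T)
  refine ⟨n, LinearMap.pi s, ⟨n, LinearMap.id, Function.surjective_id⟩, ?_⟩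
  rintro Z ⟨m, q, hq⟩
  refine exists_extension_of_surjective_pi (fun f ↦ ?_) hq
  obtain ⟨c, rfl⟩ : ∃ c : Fin n → Module.End A T, ∑ i, c i • s i = f :=
    (Submodule.mem_span_range_iff_exists_fun _).1 (hs ▸ Submodule.mem_top)
  refine ⟨∑ i, c i ∘ₗ LinearMap.proj i, ?_⟩
  ext x
  simp [LinearMap.sum_apply]

instance finite_linearMap_fin (T : FGModuleCat.{u} A) [Module.Finite (Module.End A T) T] (r : ℕ) :
    Module.Finite (Module.End A T) ((Fin r → A) →ₗ[A] T) :=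
  .equiv ((Pi.basisFun A (Fin r)).constr (Module.End A T))

variable {T : FGModuleCat.{u} A} [Module.Finite (Module.End A T) T]

theorem exists_leftApproximation_gen (hT : leftExtPerp (Gen T) T) (M : FGModuleCat.{u} A) :
    ∃ (Y X : FGModuleCat.{u} A) (g : M →ₗ[A] Y) (c : Y →ₗ[A] X), leftExtPerp (Gen T) X ∧
      Gen T Y ∧ Function.Exact g c ∧ Function.Surjective c ∧ IsLeftApproximation (Gen T) g := by
  obtain ⟨r, π, hπ⟩ := Module.Finite.exists_fin' A M
  obtain ⟨n, g, -, hg⟩ := exists_isLeftApproximation_gen_of_projective T (.of A (Fin r → A))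
  let X := FGModuleCat.of A ((Fin n → T) ⧸ LinearMap.range g)
  let Y := FGModuleCat.of A (Pushout π g)
  have hgX : Function.Exact g (LinearMap.range g).mkQ := LinearMap.exact_map_mkQ_range g
  let c : Y →ₗ[A] X := Pushout.desc 0 (LinearMap.range g).mkQ hgX.linearMap_comp_eq_zero.symm
  have hX : leftExtPerp (Gen T) X := fun Z hZ ↦
    (ExtOneVanishes.pi (hT Z hZ)).of_exact
      (LinearMap.range g).mkQ_surjective hgX (hg Z hZ)
  have hY : Gen T Y := ⟨n, Pushout.inr π g, Pushout.inr_surjective hπ⟩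
  have hc : Function.Surjective c :=
    Pushout.desc_surjective_of_right (LinearMap.range g).mkQ_surjective _
  refine ⟨Y, X, Pushout.inl π g, c, hX, hY, Pushout.exact_inl_desc hgX _, hc, hY, fun Z hZ h ↦ ?_⟩
  obtain ⟨h', hh'⟩ := hg Z hZ (h ∘ₗ π)
  exact ⟨Pushout.desc h h' hh'.symm, LinearMap.ext (Pushout.desc_inl hh'.symm)⟩

theorem exists_rightApproximation_leftExtPerp_gen [IsNoetherianRing A]
    (hT : leftExtPerp (Gen T) T) (M : FGModuleCat.{u} A) :
    ∃ (Y X : FGModuleCat.{u} A) (i : Y →ₗ[A] X) (f : X →ₗ[A] M), leftExtPerp (Gen T) X ∧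
      Gen T Y ∧ Function.Injective i ∧ Function.Exact i f ∧ Function.Surjective f ∧
      IsRightApproximation (leftExtPerp (Gen T)) f := by
  obtain ⟨m, π, hπ⟩ := Module.Finite.exists_fin' A M
  obtain ⟨r, δ, hδ⟩ := Module.Finite.exists_fin' A (LinearMap.ker π)
  let ω : (Fin r → A) →ₗ[A] (Fin m → A) := (LinearMap.ker π).subtype ∘ₗ δ
  have hωπ : Function.Exact ω π := by
    rw [LinearMap.exact_iff, LinearMap.range_comp_of_range_eq_top _ (LinearMap.range_eq_top.2 hδ),
      Submodule.range_subtype]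
  obtain ⟨n, g, -, hg⟩ := exists_isLeftApproximation_gen_of_projective T (.of A (Fin r → A))
  let X := FGModuleCat.of A (Pushout ω g)
  let f : X →ₗ[A] M := Pushout.desc π 0 hωπ.linearMap_comp_eq_zero
  let Y := FGModuleCat.of A (LinearMap.ker f)
  have hf : Function.Surjective f := Pushout.desc_surjective_of_left hπ _
  have hX : leftExtPerp (Gen T) X := fun Z hZ ↦ by
    refine (ExtOneVanishes.of_projective.prod (.pi (hT Z hZ))).of_exact
      (Submodule.mkQ_surjective _) (LinearMap.exact_map_mkQ_range _) fun b ↦ ?_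
    obtain ⟨c, rfl⟩ := hg Z hZ b
    exact ⟨-c ∘ₗ LinearMap.snd A _ _, by ext; simp⟩
  have hY : Gen T Y := by
    have hgf := Pushout.exact_inr_desc (g := g) hωπ hωπ.linearMap_comp_eq_zero
    refine ⟨n, (Pushout.inr ω g).codRestrict _ fun y ↦ hgf.apply_apply_eq_zero y, ?_⟩
    exact fun ⟨x, hx⟩ ↦ ((hgf x).1 hx).imp fun _ ↦ Subtype.ext
  exact ⟨Y, X, (LinearMap.ker f).subtype, f, hX, hY, Subtype.val_injective,
    LinearMap.exact_subtype_ker_map f, hf, hX,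
    fun X' hX' ↦ ExtOneVanishes.exists_lift (hX' Y hY) hf⟩

end Gen

end TauTilting

theorem mainTheorem2_general {A : Type u} [Ring A] [IsNoetherianRing A] (T : FGModuleCat.{u} A)
    [Module.Finite (Module.End A T) T] (hT : TauTilting.leftExtPerp (TauTilting.Gen T) T) :
    TauTilting.IsLeftWeakCotorsionPair
      (TauTilting.leftExtPerp (TauTilting.Gen T)) (TauTilting.Gen T) where
  ext_vanishes _ Y hX hY := hX Y hY
  exists_right := TauTilting.exists_rightApproximation_leftExtPerp_gen hT
  exists_left := TauTilting.exists_leftApproximation_gen hT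

theorem mainTheorem2 {k : Type w} {A : Type u} [Field k] [Ring A] [Algebra k A]
    [FiniteDimensional k A] (T : FGModuleCat.{u} A)
    (hT : TauTilting.IsSupportTauTilting k T) :
    TauTilting.IsLeftWeakCotorsionPair
      (TauTilting.leftExtPerp (TauTilting.Gen T)) (TauTilting.Gen T) := by
  have : IsNoetherianRing A := .of_finite k A
  have : Module.Finite (Module.End A T) T := TauTilting.finite_moduleEnd k
  exact mainTheorem2_general T hT.leftExtPerp_gen
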